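/- Let $k$ be a field and let $S$ be a finite poset. An $S$-space is a family $\mathbf V=(V,V(s))_{s\in S}$, where $V$ is a finite dimensional $k$-vector space (the ambient space), each $V(s)$ is a subspace of $V$, and $s\le t$ implies $V(s)\subseteq V(t)$. A morphism $\mathbf U\to\mathbf V$ is a linear map $f:U\to V$ with $f(U(s))\subseteq V(s)$ for all $s\in S$; direct sums are formed componentwise. Write $S\text{-sp}$ for the category of $S$-spaces. An $S$-space $\mathbf V$ is trivial at $t\in S$ if $V(t)=0$. For a poset embedding $R\subseteq S$, the functor $\mathrm{res}^S_R:S\text{-sp}\to R\text{-sp}$ keeps the ambient space and forgets the subspaces $V(s)$ with $s\notin R$, and $\mathrm{ind}^S_R:R\text{-sp}\to S\text{-sp}$ keeps the ambient space and puts $\sum_{r\in R,\,r\le s}V(r)$ at $s\in S$; both leave the underlying linear maps of morphisms unchanged. For $p\in S$, the functor $E^p:S\text{-sp}\to S\text{-sp}$ sends $\mathbf V$ to $(V(p),\,V(s)\cap V(p))_{s\in S}$ and a morphism $f:\mathbf U\to\mathbf V$ to $f|_{U(p)}$. Let $\check a(S)$ be the set of nonempty antichains of $S$, ordered by $A\le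 B$ if and only if every $a\in A$ satisfies $a\le b$ for some $b\in B$. Then $S$ is a subposet of $\check a(S)$ via $s\mapsto\{s\}$, and $a_1\vee\dots\vee a_m$ stands for the antichain $\{a_1,\dots,a_m\}$. For $p\in S$ put $(p)=\{s\in S: s\le p\}$ and $\langle p\rangle=\{s\in S: p\le s\}$. Let $S^{(p)}=(p)\cup\check a(S\setminus(p))$, a subposet of $\check a(S)$ containing $S$, and let $$S^p=\{t\in S^{(p)}: p\not\le t\}=\bigl((p)\setminus\{p\}\bigr)\cup\check a\bigl(S\setminus[(p)\cup\langle p\rangle]\bigr).$$ **Theorem.** Let $p\in S$ be such that every antichain contained in $S\setminus(p)$ has at most two elements (that is, $w(S\setminus(p))\le 2$), and let $$F=\mathrm{res}^{S^{(p)}}_{S^p}\,E^p\,\mathrm{ind}^{S^{(p)}}_{S}:S\text{-sp}\to S^p\text{-sp}.$$ (a) Let $\mathfrak B$ be the full subcategory of $S\text{-sp}$ determined by the $S$-spaces with no nonzero direct summand trivial at $p$. The restriction of $F$ to $\mathfrak B$ is a representation equivalence $\mathfrak B\to S^p\text{-sp}$, that is, it is full, dense, and reflects isomorphisms. (b) Let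 $\mathfrak T$ be the two-sided ideal of $S\text{-sp}$ consisting of all morphisms that factor through an $S$-space trivial at $p$. The functor $F$ induces an equivalence of categories $S\text{-sp}/\mathfrak T\cong S^p\text{-sp}$. (c) Every element of $S^p$ is either an element $t\in S\setminus\langle p\rangle$ or of the form $a\vee b$ with $a,b\in S\setminus[(p)\cup\langle p\rangle]$ and $\{p,a,b\}$ an antichain. For each $S$-space $\mathbf V=(V,V(s))_{s\in S}$ we have $F\mathbf V=(X,X(t))_{t\in S^p}$, where $X=V(p)$, $X(t)=V(t)\cap V(p)$ if $t\in S\setminus\langle p\rangle$, and $X(a\vee b)=(V(a)+V(b))\cap V(p)$ if $a,b\in S\setminus[(p)\cup\langle p\rangle]$ and $\{p,a,b\}$ is an antichain. If $f:\mathbf U\to\mathbf V$ is a morphism of $S$-spaces, then $Ff$ is given by the linear map $f|_{U(p)}:U(p)\to V(p)$. -/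

import Mathlib

open CategoryTheory

universe u v w x

namespace PosetRep

/-! ## Posets of antichains -/

/-- The width of a subset `T` of a poset: the supremum of the cardinalities of the antichains
contained in `T`. -/
noncomputable def width {S : Type v} [PartialOrder S] (T : Set S) : ℕ∞ :=
  ⨆ A ∈ {A : Set S | A ⊆ T ∧ IsAntichain (· ≤ ·) A}, A.encard

/-- Nonempty antichains of `S`. The antichain `{a₁, …, aₘ}` plays the role of `a₁ ∨ … ∨ aₘ`. -/
@[ext]
structure JoinAntichain (S : Type v) [PartialOrder S] where
  /-- the underlying set -/
  carrier : Set S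
  nonempty : carrier.Nonempty
  antichain : IsAntichain (· ≤ ·) carrier

/-- `A ≤ B` iff every element of `A` lies below some element of `B`. -/
instance JoinAntichain.instPartialOrder (S : Type v) [PartialOrder S] :
    PartialOrder (JoinAntichain S) where
  le A B := ∀ a ∈ A.carrier, ∃ b ∈ B.carrier, a ≤ b
  le_refl A a ha := ⟨a, ha, le_rfl⟩
  le_trans A B C hAB hBC a ha := by
    obtain ⟨b, hb, hab⟩ := hAB a ha
    obtain ⟨c, hc, hbc⟩ := hBC b hb
    exact ⟨c, hc, hab.trans hbc⟩
  le_antisymm A B hAB hBA := by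
    have key : ∀ X Y : JoinAntichain S,
        (∀ a ∈ X.carrier, ∃ b ∈ Y.carrier, a ≤ b) →
        (∀ a ∈ Y.carrier, ∃ b ∈ X.carrier, a ≤ b) → X.carrier ⊆ Y.carrier := by
      intro X Y hXY hYX a ha
      obtain ⟨b, hb, hab⟩ := hXY a ha
      obtain ⟨c, hc, hbc⟩ := hYX b hb
      have hac : a = c := X.antichain.eq ha hc (hab.trans hbc)
      have hba : b = a := le_antisymm (hac ▸ hbc) hab
      exact hba ▸ hb
    exact JoinAntichain.ext (Set.Subset.antisymm (key A B hAB hBA) (key B A hBA hAB))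

/-- For a subset `R` of `S`, the poset `S^R = R ∪ ǎ(S ∖ R)`, a subposet of the poset of nonempty
antichains of `S`: its elements are the singletons `{r}`, `r ∈ R`, and the nonempty antichains
contained in `S ∖ R`. -/
abbrev AntichainExt {S : Type v} [PartialOrder S] (R : Set S) : Type v :=
  {A : JoinAntichain S // (∃ r ∈ R, A.carrier = {r}) ∨ A.carrier ⊆ Rᶜ}

/-- The embedding `s ↦ {s}` of `S` into `S^R`. -/
def AntichainExt.embed {S : Type v} [PartialOrder S] (R : Set S) : S ↪o AntichainExt R where
  toFun s := ⟨⟨{s}, Set.singleton_nonempty s, IsAntichain.singleton⟩, by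
    by_cases h : s ∈ R
    · exact Or.inl ⟨s, h, rfl⟩
    · exact Or.inr (Set.singleton_subset_iff.2 h)⟩
  inj' s t h := by
    have h2 := congrArg (fun A : AntichainExt R => A.1.carrier) h
    exact Set.singleton_injective h2
  map_rel_iff' := by
    intro s t
    constructor
    · intro h
      obtain ⟨b, hb, hsb⟩ := h s rfl
      exact (Set.mem_singleton_iff.1 hb) ▸ hsb
    · rintro h a rfl
      exact ⟨t, rfl, h⟩

/-- The poset `S^{(p)} = (p) ∪ ǎ(S ∖ (p))`, where `(p)` is the principal ideal of `p`. -/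
abbrev IdealExt {S : Type v} [PartialOrder S] (p : S) : Type v :=
  AntichainExt (Set.Iic p)

/-- The embedding of `S` into `S^{(p)}`. -/
abbrev IdealExt.embed {S : Type v} [PartialOrder S] (p : S) : S ↪o IdealExt p :=
  AntichainExt.embed (Set.Iic p)

/-- The derived poset `S^p`: the complement in `S^{(p)}` of the principal filter of `S^{(p)}`
generated by `p`. -/
abbrev DerivedPoset {S : Type v} [PartialOrder S] (p : S) : Type v :=
  {A : IdealExt p // ¬ IdealExt.embed p p ≤ A}

/-- The inclusion of `S^p` into `S^{(p)}`. -/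
abbrev DerivedPoset.incl {S : Type v} [PartialOrder S] (p : S) : DerivedPoset p ↪o IdealExt p :=
  OrderEmbedding.subtype _

/-- An element `s` of `S` not above `p`, as an element of `S^p`. -/
def DerivedPoset.ofElem {S : Type v} [PartialOrder S] (p s : S) (h : s ∈ (Set.Ici p)ᶜ) :
    DerivedPoset p :=
  ⟨IdealExt.embed p s, fun hle => h ((IdealExt.embed p).le_iff_le.1 hle)⟩

/-- The element `a ∨ b` of `S^p`, where `a, b` are outside of `(p) ∪ ⟨p⟩` and `{p, a, b}` is an
antichain. -/
def DerivedPoset.join {S : Type v} [PartialOrder S] (p a b : S)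
    (ha : a ∈ (Set.Iic p ∪ Set.Ici p)ᶜ) (hb : b ∈ (Set.Iic p ∪ Set.Ici p)ᶜ)
    (h : IsAntichain (· ≤ ·) ({p, a, b} : Set S)) : DerivedPoset p :=
  ⟨⟨⟨{a, b}, Set.insert_nonempty _ _, h.subset (Set.subset_insert _ _)⟩, by
      refine Or.inr ?_
      rintro s (rfl | rfl)
      · exact fun hs => ha (Or.inl hs)
      · exact fun hs => hb (Or.inl hs)⟩, by
    intro hle
    obtain ⟨s, hs, hps⟩ := hle p rfl
    rcases hs with rfl | rfl
    · exact ha (Or.inr hps)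
    · exact hb (Or.inr hps)⟩

/-! ## The category of `S`-spaces -/

/-- An `S`-space over `k`: a finite dimensional vector space (the ambient space) with a monotone
family of subspaces indexed by `S`. -/
structure SSpace (k : Type u) [Field k] (S : Type v) [PartialOrder S] where
  /-- the ambient space -/
  carrier : Type u
  [addCommGroup : AddCommGroup carrier]
  [module : Module k carrier]
  [finiteDimensional : FiniteDimensional k carrier]
  /-- the subspaces -/
  sub : S → Submodule k carrier
  mono : Monotone sub

attribute [instance] SSpace.addCommGroup SSpace.module SSpace.finiteDimensional

namespace SSpace

variable {k : Type u} [Field k] {S : Type v} [PartialOrder S]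

/-- A morphism of `S`-spaces is a linear map of the ambient spaces that carries each subspace
into the corresponding subspace. -/
@[ext]
structure Hom (U V : SSpace k S) where
  /-- the underlying linear map -/
  toLin : U.carrier →ₗ[k] V.carrier
  map_le : ∀ s, (U.sub s).map toLin ≤ V.sub s

instance instCategory : Category (SSpace k S) where
  Hom U V := Hom U V
  id U := ⟨LinearMap.id, fun s => by rw [Submodule.map_id]⟩
  comp f g := ⟨g.toLin ∘ₗ f.toLin, fun s => by
    rw [Submodule.map_comp]
    exact (Submodule.map_mono (f.map_le s)).trans (g.map_le s)⟩

/-- The linear map underlying a morphism of `S`-spaces. -/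
abbrev lin {U V : SSpace k S} (f : U ⟶ V) : U.carrier →ₗ[k] V.carrier := Hom.toLin f

lemma hom_ext {U V : SSpace k S} {f g : U ⟶ V} (h : lin f = lin g) : f = g := Hom.ext h

lemma lin_mem {U V : SSpace k S} (f : U ⟶ V) {s : S} {x : U.carrier} (hx : x ∈ U.sub s) :
    lin f x ∈ V.sub s :=
  f.map_le s (Submodule.mem_map_of_mem hx)

@[simp] lemma lin_id (U : SSpace k S) : lin (𝟙 U) = LinearMap.id := rfl

@[simp] lemma lin_comp {U V W : SSpace k S} (f : U ⟶ V) (g : V ⟶ W) :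
    lin (f ≫ g) = lin g ∘ₗ lin f := rfl

/-- The morphisms `U ⟶ V`, viewed as a space of linear maps. -/
def homSubmodule (U V : SSpace k S) : Submodule k (U.carrier →ₗ[k] V.carrier) where
  carrier := {f | ∀ s, ∀ x ∈ U.sub s, f x ∈ V.sub s}
  add_mem' hf hg s x hx := (V.sub s).add_mem (hf s x hx) (hg s x hx)
  zero_mem' s _ _ := (V.sub s).zero_mem
  smul_mem' c _ hf s x hx := (V.sub s).smul_mem c (hf s x hx)

/-- Morphisms of `S`-spaces correspond to the elements of `homSubmodule`. -/
def homEquiv (U V : SSpace k S) : (U ⟶ V) ≃ homSubmodule U V where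
  toFun f := ⟨lin f, fun _ _ hx => lin_mem f hx⟩
  invFun f := Hom.mk f.1 fun s => Submodule.map_le_iff_le_comap.2 fun x hx => f.2 s x hx
  left_inv _ := rfl
  right_inv _ := rfl

/-- Pointwise addition of morphisms. -/
abbrev homAddCommGroup (U V : SSpace k S) : AddCommGroup (U ⟶ V) :=
  (homEquiv U V).addCommGroup

instance instPreadditive : Preadditive (SSpace k S) where
  homGroup := homAddCommGroup
  add_comp _ _ _ f f' g := hom_ext (LinearMap.comp_add (lin f) (lin f') (lin g))
  comp_add _ _ _ f g g' := hom_ext (LinearMap.add_comp (lin f) (lin g') (lin g))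

/-- Pointwise scalar multiplication of morphisms. -/
abbrev homModule (U V : SSpace k S) : Module k (U ⟶ V) :=
  (homEquiv U V).module k

instance instLinear : Linear k (SSpace k S) where
  homModule := homModule
  smul_comp _ _ _ c f g := hom_ext (LinearMap.comp_smul (lin g) c (lin f))
  comp_smul _ _ _ f c g := hom_ext (LinearMap.smul_comp c (lin g) (lin f))

@[simp] lemma lin_add {U V : SSpace k S} (f g : U ⟶ V) : lin (f + g) = lin f + lin g := rfl
@[simp] lemma lin_zero (U V : SSpace k S) : lin (0 : U ⟶ V) = 0 := rfl
@[simp] lemma lin_sub {U V : SSpace k S} (f g : U ⟶ V) : lin (f - g) = lin f - lin g := rfl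
@[simp] lemma lin_smul {U V : SSpace k S} (c : k) (f : U ⟶ V) : lin (c • f) = c • lin f := rfl

/-- The direct sum of two `S`-spaces. -/
def directSum (U V : SSpace k S) : SSpace k S where
  carrier := U.carrier × V.carrier
  sub s := (U.sub s).prod (V.sub s)
  mono _ _ h := Submodule.prod_mono (U.mono h) (V.mono h)

/-- An `S`-space is trivial at `t` if its subspace at `t` is zero. -/
def IsTrivialAt (V : SSpace k S) (t : S) : Prop := V.sub t = ⊥

/-- The property of having no nonzero direct summand trivial at `p`. -/
def noTrivialSummand (k : Type u) [Field k] (p : S) : ObjectProperty (SSpace k S) := fun V =>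
  ∀ U W : SSpace k S, Nonempty (V ≅ U.directSum W) → W.IsTrivialAt p → Subsingleton W.carrier

/-- The morphisms `U ⟶ V` that factor through an `S`-space trivial at `p`. -/
def trivialIdeal (p : S) (U V : SSpace k S) : Submodule k (U ⟶ V) where
  carrier := {f | ∃ X : SSpace k S, X.IsTrivialAt p ∧ ∃ (g : U ⟶ X) (h : X ⟶ V), f = g ≫ h}
  zero_mem' := by
    refine ⟨⟨U.carrier, fun _ => ⊥, fun _ _ _ => le_rfl⟩, rfl, 0, 0, ?_⟩
    exact hom_ext (LinearMap.comp_zero _).symm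
  add_mem' := by
    rintro f f' ⟨X, hX, g, h, rfl⟩ ⟨X', hX', g', h', rfl⟩
    refine ⟨X.directSum X', ?_,
      Hom.mk ((lin g).prod (lin g')) fun s => Submodule.map_le_iff_le_comap.2 fun x hx =>
        ⟨lin_mem g hx, lin_mem g' hx⟩,
      Hom.mk ((lin h).coprod (lin h')) fun s => Submodule.map_le_iff_le_comap.2 fun x hx =>
        (V.sub s).add_mem (lin_mem h hx.1) (lin_mem h' hx.2), ?_⟩
    · change (X.sub p).prod (X'.sub p) = ⊥
      rw [hX, hX', Submodule.prod_bot]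
    · apply hom_ext
      ext x
      rfl
  smul_mem' := by
    rintro c f ⟨X, hX, g, h, rfl⟩
    exact ⟨X, hX, c • g, h, hom_ext (LinearMap.comp_smul (lin h) c (lin g)).symm⟩

/-- Congruence modulo the two-sided ideal of morphisms that factor through an `S`-space trivial
at `p`. -/
def trivialRel (k : Type u) [Field k] (p : S) : HomRel (SSpace k S) := fun U V f g =>
  f - g ∈ trivialIdeal p U V

/-- `trivialIdeal` is a two-sided ideal, so that the quotient category below has the quotient
spaces `(U ⟶ V) ⧸ trivialIdeal p U V` as its spaces of morphisms. -/
instance trivialRel_congruence (p : S) : Congruence (trivialRel k p) where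
  equivalence {U V} :=
    { refl := fun f => by
        change f - f ∈ trivialIdeal p U V
        rw [sub_self]
        exact (trivialIdeal p U V).zero_mem
      symm := fun {f g} h => by
        change g - f ∈ trivialIdeal p U V
        rw [← neg_sub]
        exact (trivialIdeal p U V).neg_mem h
      trans := fun {f g e} h h' => by
        change f - e ∈ trivialIdeal p U V
        rw [← sub_add_sub_cancel f g e]
        exact (trivialIdeal p U V).add_mem h h' }
  comp_left {U V W} f g g' h := by
    obtain ⟨X, hX, a, b, hab⟩ := h
    exact ⟨X, hX, f ≫ a, b, by rw [← Preadditive.comp_sub, hab, Category.assoc]⟩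
  comp_right {U V W} f f' g h := by
    obtain ⟨X, hX, a, b, hab⟩ := h
    exact ⟨X, hX, a, b ≫ g, by rw [← Preadditive.sub_comp, hab, Category.assoc]⟩

/-- The category of `S`-spaces modulo the morphisms that factor through an `S`-space trivial
at `p`. -/
abbrev TrivialQuotient (k : Type u) [Field k] (p : S) := CategoryTheory.Quotient (trivialRel k p)

/-! ## Restriction, induction, and reduction of the ambient space -/

/-- Restriction along the embedding of a subposet. -/
def res (k : Type u) [Field k] {R : Type w} [PartialOrder R] (j : R ↪o S) :
    SSpace k S ⥤ SSpace k R where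
  obj V :=
    { carrier := V.carrier
      sub := fun r => V.sub (j r)
      mono := fun _ _ h => V.mono (j.monotone h) }
  map {U V} f := Hom.mk (lin (U := U) (V := V) f) fun r => f.map_le (j r)

/-- Induction along the embedding of a subposet: the subspace at `s` is the sum of the subspaces
at the `r ≤ s`. -/
def ind (k : Type u) [Field k] {R : Type w} [PartialOrder R] (j : R ↪o S) :
    SSpace k R ⥤ SSpace k S where
  obj V :=
    { carrier := V.carrier
      sub := fun s => ⨆ (r : R) (_ : j r ≤ s), V.sub r
      mono := fun _ _ h => iSup₂_le fun r hr =>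
        le_iSup₂_of_le (f := fun (r : R) (_ : j r ≤ _) => V.sub r) r (hr.trans h) le_rfl }
  map {U V} f := Hom.mk (lin (U := U) (V := V) f) fun s => by
    change Submodule.map (lin (U := U) (V := V) f) (⨆ (r : R) (_ : j r ≤ s), U.sub r)
      ≤ ⨆ (r : R) (_ : j r ≤ s), V.sub r
    simp only [Submodule.map_iSup]
    exact iSup₂_mono fun r _ => f.map_le r

/-- The functor `E^p`: the ambient space becomes `V(p)` and the subspaces `V(s) ∩ V(p)`. -/
def ambientReduce (k : Type u) [Field k] (p : S) : SSpace k S ⥤ SSpace k S where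
  obj V :=
    { carrier := V.sub p
      sub := fun s => (V.sub s).comap (V.sub p).subtype
      mono := fun _ _ h => Submodule.comap_mono (V.mono h) }
  map f := Hom.mk ((lin f).restrict fun _ hx => lin_mem f hx) fun s =>
    Submodule.map_le_iff_le_comap.2 fun _ hx => lin_mem f hx

/-- The inclusion of the ambient space of `E^p V` into the ambient space of `V`. -/
def ambientIncl (p : S) (V : SSpace k S) :
    ((ambientReduce k p).obj V).carrier →ₗ[k] V.carrier :=
  (V.sub p).subtype

/-- The differentiation functor with respect to the principal ideal of `S` generated by `p`:
induction from `S` to `S^{(p)}`, followed by `E^p`, followed by restriction to `S^p`. -/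
def diff (k : Type u) [Field k] (p : S) : SSpace k S ⥤ SSpace k (DerivedPoset p) :=
  ind k (IdealExt.embed p) ⋙ ambientReduce k (IdealExt.embed p p) ⋙ res k (DerivedPoset.incl p)

/-- The ambient space of `diff k p` applied to `V` is by construction a subspace of the ambient
space of `V`; this is the inclusion. -/
def diffIncl (p : S) (V : SSpace k S) :
    ((diff k p).obj V).carrier →ₗ[k] V.carrier :=
  ambientIncl (IdealExt.embed p p) ((ind k (IdealExt.embed p)).obj V)

end SSpace

/-- A representation equivalence: a functor that is full, dense, and reflects isomorphisms. -/
structure IsRepresentationEquivalence {C : Type u} [Category.{v} C] {D : Type w} [Category.{x} D]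
    (F : C ⥤ D) : Prop where
  full : F.Full
  dense : F.EssSurj
  reflects : F.ReflectsIsomorphisms

end PosetRep

/-! Everything rests on two facts about `F = diff k p`: it is full, and a morphism `f` has `F f = 0`
exactly when `f` vanishes on `U(p)`, that is, when `f` factors through `U ⧸ U(p)`, which is trivial
at `p`. So `trivialIdeal` is the kernel of `F`, and once `F` is full and dense the quotient
statement is formal.

Fullness (`diff_full`) is an extension problem: a map given on `U(p)` must be extended to `U`
compatibly with all `U(t)`, `t ≰ p`. Since `S ∖ (p)` has width at most two, the family `V(t)` on
this set splits into one-dimensional pieces (`WidthLeTwo.exists_coordinates`), so the map can be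
extended one coordinate at a time. Each coordinate has to vanish on a sum of members of the family
`U(t)`. By the width bound this sum is `0`, `U(a)` or `U(a) + U(b)`, and the conditions at `a` and
`a ∨ b` recorded by `F` are what is needed.

Density (`diff_essSurj`) comes from an explicit preimage `integral`: for each pair `(a, b)` a new
copy of `X` is adjoined, through which every `x ∈ X(a ∨ b)` becomes a sum of a vector at `a` and a
vector at `b`.

Splitting off summands trivial at `p` does not change `F V`, so `F` stays dense on the spaces
without such summands. There it reflects isomorphisms: if `F h = 1`, then `1 - h` kills `V(p)`, and
by Fitting's lemma the image of a high power of it is a summand trivial at `p`, hence zero. Thus `1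
- h` is nilpotent and `h` is invertible. -/

namespace PosetRep

/-! ## Posets of width at most two -/

/-- Among any three elements of `T` two are comparable. -/
def WidthLeTwo (T : Type v) [PartialOrder T] : Prop :=
  ∀ a b c : T, a ≤ b ∨ b ≤ a ∨ a ≤ c ∨ c ≤ a ∨ b ≤ c ∨ c ≤ b

lemma widthLeTwo_of_width_le {S : Type v} [PartialOrder S] {T : Set S} (h : width T ≤ 2) :
    WidthLeTwo T := by
  rintro ⟨a, ha⟩ ⟨b, hb⟩ ⟨c, hc⟩
  simp only [Subtype.mk_le_mk]
  by_contra! hcon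
  obtain ⟨h1, h2, h3, h4, h5, h6⟩ := hcon
  have hA : IsAntichain (· ≤ ·) ({a, b, c} : Set S) := by
    rintro x (rfl | rfl | rfl) y (rfl | rfl | rfl) hxy <;> first | exact absurd rfl hxy | assumption
  have hsub : ({a, b, c} : Set S) ⊆ T := by
    rintro x (rfl | rfl | rfl) <;> assumption
  have hle : ({a, b, c} : Set S).encard ≤ width T :=
    le_iSup₂_of_le (f := fun (A : Set S) (_ : A ∈ {A : Set S | A ⊆ T ∧ IsAntichain (· ≤ ·) A}) =>
      A.encard) _ ⟨hsub, hA⟩ le_rfl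
  have h3 : ({a, b, c} : Set S).encard = 3 := by
    refine Set.encard_eq_three.2 ⟨a, b, c, ?_, ?_, ?_, rfl⟩ <;> rintro rfl
    · exact h1 le_rfl
    · exact h3 le_rfl
    · exact h5 le_rfl
  rw [h3] at hle
  exact absurd (hle.trans h) (by decide)

/-- A subset of a finite poset of width at most two is empty, or has a greatest element, or is
dominated by two incomparable elements. -/
lemma WidthLeTwo.cofinal {T : Type v} [PartialOrder T] [Finite T] (hT : WidthLeTwo T)
    (I : Set T) :
    I = ∅ ∨ (∃ a ∈ I, ∀ t ∈ I, t ≤ a) ∨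
      ∃ a ∈ I, ∃ b ∈ I, ¬ a ≤ b ∧ ¬ b ≤ a ∧ ∀ t ∈ I, t ≤ a ∨ t ≤ b := by
  rcases I.eq_empty_or_nonempty with h | ⟨x, hx⟩
  · exact Or.inl h
  have hmax : ∀ y ∈ I, ∃ m, y ≤ m ∧ Maximal (· ∈ I) m := fun y hy =>
    (Set.toFinite I).exists_le_maximal hy
  obtain ⟨a, -, ha⟩ := hmax x hx
  by_cases hA : ∀ t ∈ I, t ≤ a
  · exact Or.inr (Or.inl ⟨a, ha.prop, hA⟩)
  push Not at hA
  obtain ⟨y, hy, hya⟩ := hA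
  obtain ⟨b, hyb, hb⟩ := hmax y hy
  have hba : ¬ b ≤ a := fun h => hya (hyb.trans h)
  have hab : ¬ a ≤ b := fun h => hba (ha.le_of_ge hb.prop h)
  refine Or.inr (Or.inr ⟨a, ha.prop, b, hb.prop, hab, hba, fun t ht => ?_⟩)
  obtain ⟨m, htm, hm⟩ := hmax t ht
  rcases hT a b m with h | h | h | h | h | h
  · exact absurd h hab
  · exact absurd h hba
  · exact Or.inl (htm.trans (ha.le_of_ge hm.prop h))
  · exact Or.inl (htm.trans h)
  · exact Or.inr (htm.trans (hb.le_of_ge hm.prop h))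
  · exact Or.inr (htm.trans h)

/-! ## Coordinates adapted to a family of subspaces -/

section LinearAlgebra

variable {k : Type u} [Field k] {T : Type v} [PartialOrder T] [Finite T]

/-- A linear form on a subspace `X` that vanishes on `X ∩ W` extends to a linear form that
vanishes on `W`. -/
lemma exists_dual_extension {U : Type w} [AddCommGroup U] [Module k U] (X W : Submodule k U)
    (χ : X →ₗ[k] k) (h : ∀ x : X, (x : U) ∈ W → χ x = 0) :
    ∃ ψ : U →ₗ[k] k, (∀ x : X, ψ x = χ x) ∧ ∀ y ∈ W, ψ y = 0 := by
  -- The map `X → U ⧸ W` has kernel `X ∩ W`, and over a field the forms that kill the kernel of a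
  -- map are precisely those pulled back along it.
  have hχ : χ ∈ LinearMap.range (W.mkQ ∘ₗ X.subtype).dualMap := by
    rw [LinearMap.range_dualMap_eq_dualAnnihilator_ker, Submodule.mem_dualAnnihilator]
    intro x hx
    refine h x ?_
    simpa using hx
  obtain ⟨θ, hθ⟩ := hχ
  refine ⟨θ ∘ₗ W.mkQ, fun x => ?_, fun y hy => ?_⟩
  · rw [← hθ]
    rfl
  · have : W.mkQ y = 0 := by simpa using hy
    rw [LinearMap.comp_apply, this, map_zero]

/-- For a monotone family of subspaces indexed by a finite poset of width at most two, some
nonzero vector is not in the sum of the members of the family that do not contain it. -/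
lemma WidthLeTwo.exists_notMem_iSup (hT : WidthLeTwo T) {V : Type w} [AddCommGroup V] [Module k V]
    [Nontrivial V] (W : T → Submodule k V) (hW : Monotone W) :
    ∃ v : V, v ∉ ⨆ (t : T) (_ : v ∉ W t), W t := by
  -- Take `v ≠ 0` such that the set of indices `t` with `v ∈ W t` is maximal. If `v = x + y` with `x
  -- ∈ W a`, `y ∈ W b` and `v` in neither, then `x` and `y` will be seen to lie in every member
  -- containing `v`, so maximality makes both zero.
  obtain ⟨v, hv, hmax⟩ : ∃ v : V, v ≠ 0 ∧
      ∀ w : V, w ≠ 0 → (∀ t, v ∈ W t → w ∈ W t) → ∀ t, w ∈ W t → v ∈ W t := by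
    let s : Set (Set T) := (fun v : V => {t | v ∈ W t}) '' {v | v ≠ 0}
    obtain ⟨v₀, hv₀⟩ := exists_ne (0 : V)
    obtain ⟨F, -, hF⟩ := (Set.toFinite s).exists_le_maximal ⟨v₀, hv₀, rfl⟩
    obtain ⟨v, hv, rfl⟩ := hF.prop
    exact ⟨v, hv, fun w hw hvw => hF.le_of_ge ⟨w, hw, rfl⟩ hvw⟩
  have hzero : ∀ w t, v ∉ W t → w ∈ W t → (∀ e, v ∈ W e → w ∈ W e) → w = 0 :=
    fun w t ht hwt hw => by_contra fun h0 => ht (hmax w h0 hw t hwt)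
  refine ⟨v, fun hmem => ?_⟩
  rcases hT.cofinal {t | v ∉ W t} with h | ⟨a, ha, h⟩ | ⟨a, ha, b, hb, hab, hba, h⟩
  · have : (⨆ (t : T) (_ : v ∉ W t), W t) ≤ ⊥ := iSup₂_le fun t ht => by
      have : t ∈ (∅ : Set T) := h ▸ ht
      exact this.elim
    exact hv (by simpa using this hmem)
  · have : (⨆ (t : T) (_ : v ∉ W t), W t) ≤ W a := iSup₂_le fun t ht => hW (h t ht)
    exact ha (this hmem)
  · have : (⨆ (t : T) (_ : v ∉ W t), W t) ≤ W a ⊔ W b := iSup₂_le fun t ht =>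
      (h t ht).elim (fun h => (hW h).trans le_sup_left) fun h => (hW h).trans le_sup_right
    obtain ⟨x, hx, y, hy, hxy⟩ := Submodule.mem_sup.1 (this hmem)
    -- By the width bound `e` is comparable to `a` or `b`, and it lies below neither, since `v` is
    -- in neither `W a` nor `W b`. So `W e` contains one of `x`, `y`, and the other by subtraction
    -- from `v`.
    have hcmp : ∀ e, v ∈ W e → a ≤ e ∨ b ≤ e := fun e he => by
      rcases hT a b e with h | h | h | h | h | h
      · exact absurd h hab
      · exact absurd h hba
      · exact Or.inl h
      · exact absurd (hW h he) ha
      · exact Or.inr h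
      · exact absurd (hW h he) hb
    have hx' : x = x + y - y := by abel
    have hy' : y = x + y - x := by abel
    have hx0 : x = 0 := hzero x a ha hx fun e he => by
      rcases hcmp e he with h | h
      · exact hW h hx
      · rw [hx', hxy]
        exact (W e).sub_mem he (hW h hy)
    have hy0 : y = 0 := hzero y b hb hy fun e he => by
      rcases hcmp e he with h | h
      · rw [hy', hxy]
        exact (W e).sub_mem he (hW h hx)
      · exact hW h hy
    exact hv (by rw [← hxy, hx0, hy0, add_zero])

/-- A monotone family of subspaces of a finite dimensional space, indexed by a finite poset of
width at most two, has an adapted system of coordinates. -/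
lemma WidthLeTwo.exists_coordinates (hT : WidthLeTwo T) (V : Type w) [AddCommGroup V] [Module k V]
    [FiniteDimensional k V] (W : T → Submodule k V) (hW : Monotone W) :
    ∃ (n : ℕ) (e : Fin n → V) (φ : Fin n → V →ₗ[k] k), (∀ x, ∑ i, φ i x • e i = x) ∧
      ∀ i t, e i ∈ W t ∨ ∀ x ∈ W t, φ i x = 0 := by
  induction hd : Module.finrank k V using Nat.strong_induction_on generalizing V with
  | _ d ih =>
  rcases subsingleton_or_nontrivial V with hV | hV
  · exact ⟨0, Fin.elim0, Fin.elim0, fun x => Subsingleton.elim _ _, fun i => i.elim0⟩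
  obtain ⟨v, hv⟩ := hT.exists_notMem_iSup W hW
  obtain ⟨ψ, hψv, hψ⟩ := Submodule.exists_le_ker_of_notMem hv
  let φ : V →ₗ[k] k := (ψ v)⁻¹ • ψ
  have hφv : φ v = 1 := inv_mul_cancel₀ hψv
  have hφW : ∀ t, v ∉ W t → ∀ x ∈ W t, φ x = 0 := fun t ht x hx => by
    have h0 : ψ x = 0 := hψ ((le_iSup₂ (f := fun (t : T) (_ : v ∉ W t) => W t) t ht) hx)
    simp [φ, h0]
  let H := LinearMap.ker φ
  have hlt : Module.finrank k H < d := by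
    rw [← hd]
    refine Submodule.finrank_lt fun h => ?_
    have : v ∈ H := h ▸ Submodule.mem_top
    rw [LinearMap.mem_ker, hφv] at this
    exact one_ne_zero this
  obtain ⟨n, e, χ, hsum, hadapt⟩ := ih _ hlt H (fun t => (W t).comap H.subtype)
    (fun _ _ h => Submodule.comap_mono (hW h)) rfl
  -- This is the projection onto `H` along `v`. It maps every `W t` into itself: either `v ∈ W t`,
  -- or `φ` vanishes on `W t` and `π` fixes it. This lets the coordinates of `H` be pulled back to
  -- `V`.
  let π : V →ₗ[k] H := (LinearMap.id - φ.smulRight v).codRestrict H fun x => by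
    simp [H, hφv]
  have hπ : ∀ x, (π x : V) = x - φ x • v := fun _ => rfl
  refine ⟨n + 1, Fin.cons v fun i => (e i : V), Fin.cons φ fun i => χ i ∘ₗ π, fun x => ?_, ?_⟩
  · have h := congrArg (fun y : H => (y : V)) (hsum (π x))
    simp only [Submodule.coe_sum, Submodule.coe_smul, hπ] at h
    simp [Fin.sum_univ_succ, h]
  · intro i t
    refine Fin.cases ?_ (fun i => ?_) i
    · by_cases hvt : v ∈ W t
      · exact Or.inl hvt
      · exact Or.inr (hφW t hvt)
    · refine (hadapt i t).imp id fun h x hx => h (π x) ?_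
      change (π x : V) ∈ W t
      rw [hπ]
      by_cases hvt : v ∈ W t
      · exact (W t).sub_mem hx ((W t).smul_mem _ hvt)
      · rwa [hφW t hvt x hx, zero_smul, sub_zero]

/-- Extension of a linear map from a subspace to a morphism, for a finite poset of width at
most two. -/
lemma WidthLeTwo.exists_extension (hT : WidthLeTwo T) {U V : Type w} [AddCommGroup U] [Module k U]
    [AddCommGroup V] [Module k V] [FiniteDimensional k V] (P : T → Submodule k U) (hP : Monotone P)
    (W : T → Submodule k V) (hW : Monotone W) (X : Submodule k U) (g : X →ₗ[k] V)
    (h₁ : ∀ t (x : X), (x : U) ∈ P t → g x ∈ W t)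
    (h₂ : ∀ a b, ¬ a ≤ b → ¬ b ≤ a → ∀ x : X, (x : U) ∈ P a ⊔ P b → g x ∈ W a ⊔ W b) :
    ∃ f : U →ₗ[k] V, (∀ x : X, f x = g x) ∧ ∀ t, ∀ x ∈ P t, f x ∈ W t := by
  obtain ⟨n, e, φ, hsum, hadapt⟩ := hT.exists_coordinates V W hW
  have key : ∀ i, ∃ ψ : U →ₗ[k] k, (∀ x : X, ψ x = φ i (g x)) ∧
      ∀ y ∈ ⨆ (t : T) (_ : ∀ z ∈ W t, φ i z = 0), P t, ψ y = 0 := by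
    intro i
    -- The `i`-th coordinate of the extension must kill `P t` whenever `φ i` kills `W t`. It remains
    -- to see that `φ i ∘ g` already vanishes where `X` meets the sum of these `P t`; by `cofinal`
    -- at most two of them matter.
    refine exists_dual_extension X _ (φ i ∘ₗ g) fun x hx => ?_
    rcases hT.cofinal {t | ∀ z ∈ W t, φ i z = 0} with h | ⟨a, ha, h⟩ | ⟨a, ha, b, hb, hab, hba, h⟩
    · have : (⨆ (t : T) (_ : ∀ z ∈ W t, φ i z = 0), P t) ≤ ⊥ := iSup₂_le fun t ht => by
        have : t ∈ (∅ : Set T) := h ▸ ht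
        exact this.elim
      have hx0 : x = 0 := by simpa using this hx
      rw [hx0, map_zero]
    · have : (⨆ (t : T) (_ : ∀ z ∈ W t, φ i z = 0), P t) ≤ P a := iSup₂_le fun t ht => hP (h t ht)
      exact ha _ (h₁ a x (this hx))
    · have : (⨆ (t : T) (_ : ∀ z ∈ W t, φ i z = 0), P t) ≤ P a ⊔ P b := iSup₂_le fun t ht =>
        (h t ht).elim (fun h => (hP h).trans le_sup_left) fun h => (hP h).trans le_sup_right
      obtain ⟨y, hy, z, hz, hyz⟩ := Submodule.mem_sup.1 (h₂ a b hab hba x (this hx))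
      rw [LinearMap.comp_apply, ← hyz, map_add, ha y hy, hb z hz, add_zero]
  choose ψ hψ hψ0 using key
  refine ⟨∑ i, (ψ i).smulRight (e i), fun x => ?_, fun t x hx => ?_⟩
  · simp only [LinearMap.sum_apply, LinearMap.smulRight_apply, hψ, hsum]
  · simp only [LinearMap.sum_apply, LinearMap.smulRight_apply]
    refine (W t).sum_mem fun i _ => ?_
    rcases hadapt i t with h | h
    · exact (W t).smul_mem _ h
    · have : x ∈ ⨆ (t : T) (_ : ∀ z ∈ W t, φ i z = 0), P t :=
        (le_iSup₂ (f := fun (t : T) (_ : ∀ z ∈ W t, φ i z = 0) => P t) t h) hx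
      rw [hψ0 i x this, zero_smul]
      exact (W t).zero_mem

end LinearAlgebra

/-! ## The elements of the derived poset -/

lemma IdealExt.embed_le_iff {S : Type v} [PartialOrder S] {p s : S} {t : IdealExt p} :
    IdealExt.embed p s ≤ t ↔ ∃ b ∈ t.1.carrier, s ≤ b :=
  ⟨fun h => h s rfl, fun h _ ha => (Set.mem_singleton_iff.1 ha) ▸ h⟩

lemma DerivedPoset.embed_le_join {S : Type v} [PartialOrder S] {p a b s : S}
    {ha : a ∈ (Set.Iic p ∪ Set.Ici p)ᶜ} {hb : b ∈ (Set.Iic p ∪ Set.Ici p)ᶜ}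
    {h : IsAntichain (· ≤ ·) ({p, a, b} : Set S)} :
    IdealExt.embed p s ≤ DerivedPoset.incl p (DerivedPoset.join p a b ha hb h) ↔
      s ≤ a ∨ s ≤ b := by
  rw [IdealExt.embed_le_iff]
  constructor
  · rintro ⟨c, rfl | rfl, hc⟩
    · exact Or.inl hc
    · exact Or.inr hc
  · rintro (h | h)
    · exact ⟨a, Or.inl rfl, h⟩
    · exact ⟨b, Or.inr rfl, h⟩

/-- A singleton is an element of `S`, whichever part of `S^{(p)}` it comes from. Any other antichain
lies in `S ∖ (p)`, where a third element would have to be comparable to, hence equal to, one of two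
chosen ones. -/
lemma DerivedPoset.eq_ofElem_or_eq_join {S : Type v} [PartialOrder S] {p : S}
    (hS : WidthLeTwo ((Set.Iic p)ᶜ : Set S)) (t : DerivedPoset p) :
    (∃ (s : S) (hs : s ∈ (Set.Ici p)ᶜ), t = DerivedPoset.ofElem p s hs) ∨
    (∃ (a b : S) (ha : a ∈ (Set.Iic p ∪ Set.Ici p)ᶜ) (hb : b ∈ (Set.Iic p ∪ Set.Ici p)ᶜ)
      (h : IsAntichain (· ≤ ·) ({p, a, b} : Set S)), t = DerivedPoset.join p a b ha hb h) := by
  obtain ⟨⟨A, hA⟩, hp⟩ := t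
  have hp' : ∀ s ∈ A.carrier, ¬ p ≤ s := fun s hs hps =>
    hp (IdealExt.embed_le_iff.2 ⟨s, hs, hps⟩)
  by_cases hsing : ∃ s, A.carrier = {s}
  · obtain ⟨s, hs⟩ := hsing
    refine Or.inl ⟨s, hp' s (hs ▸ rfl), ?_⟩
    exact Subtype.ext (Subtype.ext (JoinAntichain.ext hs))
  obtain ⟨a, ha⟩ := A.nonempty
  have hb : ∃ b ∈ A.carrier, b ≠ a := by
    by_contra! h
    exact hsing ⟨a, Set.eq_singleton_iff_unique_mem.2 ⟨ha, h⟩⟩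
  obtain ⟨b, hb, hba⟩ := hb
  have hA' : A.carrier ⊆ (Set.Iic p)ᶜ := by
    rcases hA with ⟨r, -, hr⟩ | hA
    · exact absurd ⟨r, hr⟩ hsing
    · exact hA
  have hcar : A.carrier = {a, b} := by
    refine Set.Subset.antisymm (fun c hc => ?_) ?_
    · have := hS ⟨a, hA' ha⟩ ⟨b, hA' hb⟩ ⟨c, hA' hc⟩
      simp only [Subtype.mk_le_mk] at this
      rcases this with h | h | h | h | h | h
      · exact absurd (A.antichain.eq ha hb h).symm hba
      · exact absurd (A.antichain.eq hb ha h) hba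
      · exact Or.inl (A.antichain.eq ha hc h).symm
      · exact Or.inl (A.antichain.eq hc ha h)
      · exact Or.inr (A.antichain.eq hb hc h).symm
      · exact Or.inr (A.antichain.eq hc hb h)
    · rintro c (rfl | rfl) <;> assumption
  have hmem : ∀ s ∈ A.carrier, s ∈ (Set.Iic p ∪ Set.Ici p)ᶜ := fun s hs =>
    not_or.2 ⟨hA' hs, hp' s hs⟩
  refine Or.inr ⟨a, b, hmem a ha, hmem b hb, ?_, ?_⟩
  · rw [← hcar]
    exact A.antichain.insert (fun s hs _ h => hA' hs h) fun s hs _ h => hp' s hs h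
  · exact Subtype.ext (Subtype.ext (JoinAntichain.ext hcar))

namespace SSpace

variable {k : Type u} [Field k] {S : Type v} [PartialOrder S] {p : S}

/-! ## Explicit description of the differentiation functor -/

/-- The sum of the subspaces of `V` at the elements of `S` below an element of `S^{(p)}`. -/
def joinSub (V : SSpace k S) (t : IdealExt p) : Submodule k V.carrier :=
  ⨆ (s : S) (_ : IdealExt.embed p s ≤ t), V.sub s

lemma joinSub_embed (V : SSpace k S) (s : S) : joinSub V (IdealExt.embed p s) = V.sub s :=
  le_antisymm (iSup₂_le fun _ hr => V.mono ((IdealExt.embed p).le_iff_le.1 hr))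
    (le_iSup₂_of_le (f := fun (r : S) (_ : IdealExt.embed p r ≤ IdealExt.embed p s) => V.sub r) s
      le_rfl le_rfl)

lemma joinSub_ofElem (V : SSpace k S) {s : S} (hs : s ∈ (Set.Ici p)ᶜ) :
    joinSub V (DerivedPoset.incl p (DerivedPoset.ofElem p s hs)) = V.sub s :=
  joinSub_embed V s

lemma joinSub_join (V : SSpace k S) {a b : S} (ha : a ∈ (Set.Iic p ∪ Set.Ici p)ᶜ)
    (hb : b ∈ (Set.Iic p ∪ Set.Ici p)ᶜ) (h : IsAntichain (· ≤ ·) ({p, a, b} : Set S)) :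
    joinSub V (DerivedPoset.incl p (DerivedPoset.join p a b ha hb h)) = V.sub a ⊔ V.sub b := by
  refine le_antisymm (iSup₂_le fun r hr => ?_) (sup_le ?_ ?_)
  · rcases DerivedPoset.embed_le_join.1 hr with h | h
    · exact (V.mono h).trans le_sup_left
    · exact (V.mono h).trans le_sup_right
  · exact le_iSup₂_of_le (f := fun (r : S) (_ : IdealExt.embed p r ≤ _) => V.sub r) a
      (DerivedPoset.embed_le_join.2 (Or.inl le_rfl)) le_rfl
  · exact le_iSup₂_of_le (f := fun (r : S) (_ : IdealExt.embed p r ≤ _) => V.sub r) b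
      (DerivedPoset.embed_le_join.2 (Or.inr le_rfl)) le_rfl

lemma diffIncl_injective (V : SSpace k S) : Function.Injective (diffIncl p V) :=
  Subtype.val_injective

lemma range_diffIncl (V : SSpace k S) : LinearMap.range (diffIncl p V) = V.sub p :=
  (Submodule.range_subtype _).trans (joinSub_embed V p)

lemma diffIncl_mem (V : SSpace k S) (x : ((diff k p).obj V).carrier) :
    diffIncl p V x ∈ V.sub p :=
  range_diffIncl V ▸ LinearMap.mem_range_self _ x

lemma map_diffIncl_sub (V : SSpace k S) (t : DerivedPoset p) :
    (((diff k p).obj V).sub t).map (diffIncl p V) =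
      joinSub V (DerivedPoset.incl p t) ⊓ V.sub p := by
  have h := Submodule.map_comap_subtype (joinSub V (IdealExt.embed p p))
    (joinSub V (DerivedPoset.incl p t))
  rw [inf_comm] at h
  exact h.trans (congrArg (joinSub V (DerivedPoset.incl p t) ⊓ ·) (joinSub_embed V p))

lemma mem_diff_sub_iff {V : SSpace k S} {t : DerivedPoset p}
    {x : ((diff k p).obj V).carrier} :
    x ∈ ((diff k p).obj V).sub t ↔
      diffIncl p V x ∈ joinSub V (DerivedPoset.incl p t) :=
  Iff.rfl

lemma diffIncl_map {U V : SSpace k S} (f : U ⟶ V) (x : ((diff k p).obj U).carrier) :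
    diffIncl p V (lin ((diff k p).map f) x) = lin f (diffIncl p U x) :=
  rfl

/-- The ambient space of `diff k p` applied to `V`, identified with `V(p)`. -/
noncomputable def diffEquiv (p : S) (V : SSpace k S) :
    V.sub p ≃ₗ[k] ((diff k p).obj V).carrier :=
  LinearEquiv.ofEq _ _ (joinSub_embed V p).symm

lemma diffIncl_diffEquiv (V : SSpace k S) (x : V.sub p) :
    diffIncl p V (diffEquiv p V x) = x :=
  rfl

/-! ## Morphisms killed by the differentiation functor -/

lemma diff_map_eq_zero_iff {U V : SSpace k S} (f : U ⟶ V) :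
    (diff k p).map f = 0 ↔ ∀ x ∈ U.sub p, lin f x = 0 := by
  constructor
  · intro h x hx
    have h' := diffIncl_map (p := p) f (diffEquiv p U ⟨x, hx⟩)
    rw [h, diffIncl_diffEquiv] at h'
    rw [← h']
    exact map_zero _
  · intro h
    apply hom_ext
    ext x
    exact diffIncl_injective V ((diffIncl_map f x).trans
      ((h _ (diffIncl_mem U x)).trans (map_zero (diffIncl p V)).symm))

lemma diff_map_sub {U V : SSpace k S} (f g : U ⟶ V) :
    (diff k p).map (f - g) = (diff k p).map f - (diff k p).map g :=
  rfl

/-- The ideal of morphisms that factor through a space trivial at `p` is the kernel of the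
differentiation functor. -/
lemma mem_trivialIdeal_iff {U V : SSpace k S} (f : U ⟶ V) :
    f ∈ trivialIdeal p U V ↔ (diff k p).map f = 0 := by
  rw [diff_map_eq_zero_iff]
  constructor
  · rintro ⟨X, hX, g, h, rfl⟩ x hx
    have h0 : lin g x ∈ X.sub p := lin_mem g hx
    rw [show X.sub p = ⊥ from hX, Submodule.mem_bot] at h0
    rw [lin_comp, LinearMap.comp_apply, h0, map_zero]
  · intro hf
    -- The quotient `U ⧸ U(p)` with the images of the `U(s)` is trivial at `p`, and every morphism
    -- vanishing on `U(p)` factors through it.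
    let X : SSpace k S :=
      { carrier := U.carrier ⧸ U.sub p
        sub := fun s => (U.sub s).map (U.sub p).mkQ
        mono := fun _ _ h => Submodule.map_mono (U.mono h) }
    refine ⟨X, Submodule.mkQ_map_self _, Hom.mk (U.sub p).mkQ fun s => le_rfl,
      Hom.mk ((U.sub p).liftQ (lin f) hf) fun s => ?_, ?_⟩
    · rintro _ ⟨_, ⟨x, hx, rfl⟩, rfl⟩
      exact lin_mem f hx
    · exact hom_ext ((U.sub p).liftQ_mkQ (lin f) hf).symm

lemma trivialRel_eq_homRel : trivialRel k p = (diff k p).homRel := by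
  funext U V f g
  apply propext
  change f - g ∈ trivialIdeal p U V ↔ (diff k p).map f = (diff k p).map g
  rw [mem_trivialIdeal_iff, diff_map_sub, sub_eq_zero]

/-! ## The differentiation functor is full -/

lemma diff_full [Finite S] (hS : WidthLeTwo ((Set.Iic p)ᶜ : Set S)) : (diff k p).Full where
  map_surjective {U V} φ := by
    let g : U.sub p →ₗ[k] V.carrier := diffIncl p V ∘ₗ lin φ ∘ₗ (diffEquiv p U).toLinearMap
    have hgp : ∀ x, g x ∈ V.sub p := fun x => diffIncl_mem V _
    have hg : ∀ (t : DerivedPoset p) (A : Submodule k U.carrier) (B : Submodule k V.carrier),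
        joinSub U (DerivedPoset.incl p t) = A → joinSub V (DerivedPoset.incl p t) = B →
        ∀ x : U.sub p, (x : U.carrier) ∈ A → g x ∈ B := by
      rintro t _ _ rfl rfl x hx
      exact mem_diff_sub_iff.1 (lin_mem φ (mem_diff_sub_iff.2 hx))
    have hg₁ : ∀ (s : S) (x : U.sub p), (x : U.carrier) ∈ U.sub s → g x ∈ V.sub s := by
      intro s x hx
      by_cases hs : p ≤ s
      · exact V.mono hs (hgp x)
      · exact hg (DerivedPoset.ofElem p s hs) _ _ (joinSub_ofElem U hs) (joinSub_ofElem V hs) x hx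
    obtain ⟨f, hf, hfs⟩ := hS.exists_extension (fun t => U.sub t) (fun _ _ h => U.mono h)
      (fun t => V.sub t) (fun _ _ h => V.mono h) (U.sub p) g (fun t x hx => hg₁ t x hx) (by
        rintro ⟨a, ha⟩ ⟨b, hb⟩ hab hba x hx
        -- If `a` or `b` is above `p`, then `V(a) + V(b)` contains `V(p)` and there is nothing to
        -- check. Otherwise `a ∨ b` is an element of `S^p`, and the condition is part of `φ` being a
        -- morphism.
        by_cases hpa : p ≤ a
        · exact Submodule.mem_sup_left (V.mono hpa (hgp x))
        by_cases hpb : p ≤ b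
        · exact Submodule.mem_sup_right (V.mono hpb (hgp x))
        have hanti : IsAntichain (· ≤ ·) ({p, a, b} : Set S) := by
          rintro x (rfl | rfl | rfl) y (rfl | rfl | rfl) hxy <;>
            first | exact absurd rfl hxy | assumption
        exact hg (DerivedPoset.join p a b (not_or.2 ⟨ha, hpa⟩) (not_or.2 ⟨hb, hpb⟩) hanti) _ _
          (joinSub_join U _ _ hanti) (joinSub_join V _ _ hanti) x hx)
    let F : U ⟶ V := Hom.mk f fun s => Submodule.map_le_iff_le_comap.2 fun x hx => by
      change f x ∈ V.sub s
      -- The extension lemma covers only `s ≰ p`; for `s ≤ p` the space `U(s)` lies in `U(p)`, where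
      -- `f` is `g`.
      by_cases hs : s ≤ p
      · rw [hf ⟨x, U.mono hs hx⟩]
        exact hg₁ s _ hx
      · exact hfs ⟨s, hs⟩ x hx
    refine ⟨F, hom_ext (LinearMap.ext fun x => diffIncl_injective V ?_)⟩
    rw [diffIncl_map]
    exact hf ⟨diffIncl p U x, diffIncl_mem U x⟩

end SSpace

namespace SSpace

variable {k : Type u} [Field k] {S : Type v} [PartialOrder S] {p : S}

/-- A linear equivalence that respects membership in the subspaces is an isomorphism. -/
def isoOfLinearEquiv {U V : SSpace k S} (e : U.carrier ≃ₗ[k] V.carrier)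
    (h : ∀ s x, x ∈ U.sub s ↔ e x ∈ V.sub s) : U ≅ V where
  hom := Hom.mk e.toLinearMap fun s => Submodule.map_le_iff_le_comap.2 fun x hx => (h s x).1 hx
  inv := Hom.mk e.symm.toLinearMap fun s => Submodule.map_le_iff_le_comap.2 fun x hx =>
    (h s _).2 (by simpa using hx)
  hom_inv_id := hom_ext (LinearMap.ext fun x => e.symm_apply_apply x)
  inv_hom_id := hom_ext (LinearMap.ext fun x => e.apply_symm_apply x)

/-- The linear equivalence underlying an isomorphism. -/
def linearEquivOfIso {U V : SSpace k S} (i : U ≅ V) : U.carrier ≃ₗ[k] V.carrier :=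
  LinearEquiv.ofLinearMap (lin i.hom) (lin i.inv)
    (by rw [← lin_comp, i.inv_hom_id, lin_id]) (by rw [← lin_comp, i.hom_inv_id, lin_id])

/-! ## The differentiation functor is dense -/

/-- Pairs of elements that form an antichain together with `p`. -/
abbrev AntichainPair (p : S) : Type v :=
  {q : S × S // q.1 ∈ (Set.Iic p ∪ Set.Ici p)ᶜ ∧ q.2 ∈ (Set.Iic p ∪ Set.Ici p)ᶜ ∧
    IsAntichain (· ≤ ·) ({p, q.1, q.2} : Set S)}

/-- The join of a pair that forms an antichain together with `p`. -/
abbrev AntichainPair.join (q : AntichainPair p) : DerivedPoset p :=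
  DerivedPoset.join p q.1.1 q.1.2 q.2.1 q.2.2.1 q.2.2.2

/-! ### Construction of a space with prescribed derivative. -/

section Integral

variable (X : SSpace k (DerivedPoset p)) {m : ℕ} (q : Fin m → AntichainPair p)

/-- The part inside of `X` of the subspace at `s` of the space constructed from `X`. -/
def integralBase (s : S) : Submodule k X.carrier :=
  -- For `s` above `p` the infimum is empty, so the value is all of `X`.
  ⨅ h : s ∈ (Set.Ici p)ᶜ, X.sub (DerivedPoset.ofElem p s h)

/-- The embedding of the copy of `X` with index `i`. -/
abbrev integralCopy (i : Fin m) : X.carrier →ₗ[k] X.carrier × (Fin m → X.carrier) :=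
  LinearMap.inr k _ _ ∘ₗ LinearMap.single k (fun _ => X.carrier) i

/-- The subspace at `s` of the space constructed from `X`. -/
def integralSub (s : S) : Submodule k (X.carrier × (Fin m → X.carrier)) :=
  (X.integralBase s).map (LinearMap.inl k _ _) ⊔
    ((⨆ (i : Fin m) (_ : (q i).1.1 ≤ s), (X.sub (q i).join).map (X.integralCopy i)) ⊔
      ⨆ (i : Fin m) (_ : (q i).1.2 ≤ s),
        (X.sub (q i).join).map (LinearMap.inl k _ _ - X.integralCopy i))

lemma integralSub_mono : Monotone (X.integralSub q) := by
  intro s t h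
  refine sup_le_sup (Submodule.map_mono (le_iInf fun ht => ?_)) (sup_le_sup ?_ ?_)
  · have hs : s ∈ (Set.Ici p)ᶜ := fun hs => ht (le_trans hs h)
    exact (iInf_le _ hs).trans (X.mono ((IdealExt.embed p).le_iff_le.2 h))
  · exact iSup_mono fun i => iSup_mono' fun hi => ⟨hi.trans h, le_rfl⟩
  · exact iSup_mono fun i => iSup_mono' fun hi => ⟨hi.trans h, le_rfl⟩

lemma inl_mem_integralSub {s : S} {x : X.carrier}
    (hx : ∀ h : s ∈ (Set.Ici p)ᶜ, x ∈ X.sub (DerivedPoset.ofElem p s h)) :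
    LinearMap.inl k X.carrier (Fin m → X.carrier) x ∈ X.integralSub q s :=
  Submodule.mem_sup_left (Submodule.mem_map_of_mem ((Submodule.mem_iInf _).2 hx))

lemma integralCopy_mem_integralSub {i : Fin m} {x : X.carrier} (hx : x ∈ X.sub (q i).join) :
    X.integralCopy i x ∈ X.integralSub q (q i).1.1 :=
  Submodule.mem_sup_right (Submodule.mem_sup_left (Submodule.mem_iSup_of_mem i
    (Submodule.mem_iSup_of_mem le_rfl (Submodule.mem_map_of_mem hx))))

lemma inl_sub_integralCopy_mem_integralSub {i : Fin m} {x : X.carrier}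
    (hx : x ∈ X.sub (q i).join) :
    LinearMap.inl k X.carrier (Fin m → X.carrier) x - X.integralCopy i x ∈
      X.integralSub q (q i).1.2 :=
  Submodule.mem_sup_right (Submodule.mem_sup_right (Submodule.mem_iSup_of_mem i
    (Submodule.mem_iSup_of_mem le_rfl ⟨x, hx, rfl⟩)))

/-- No member of a pair `q i` lies below `p`, so the new copies do not contribute at `p`. -/
lemma integralSub_self :
    X.integralSub q p = LinearMap.range (LinearMap.inl k X.carrier (Fin m → X.carrier)) := by
  refine le_antisymm (sup_le (LinearMap.map_le_range) (sup_le ?_ ?_)) ?_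
  · exact iSup₂_le fun i hi => absurd (Or.inl hi) (q i).2.1
  · exact iSup₂_le fun i hi => absurd (Or.inl hi) (q i).2.2.1
  · rintro _ ⟨x, rfl⟩
    exact X.inl_mem_integralSub q fun h => absurd le_rfl h

open Classical in
/-- The map `(x, y) ↦ x + ∑ yᵢ`, where the sum is over all `i` such that the second member of the
pair `q i` is in `L`. -/
noncomputable def integralProj (L : Set S) :
    X.carrier × (Fin m → X.carrier) →ₗ[k] X.carrier :=
  LinearMap.fst k _ _ +
    (∑ i : Fin m, if (q i).1.2 ∈ L then LinearMap.proj i else 0) ∘ₗ LinearMap.snd k _ _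

lemma integralProj_inl (L : Set S) (x : X.carrier) : X.integralProj q L (x, 0) = x := by
  simp [integralProj]

open Classical in
lemma integralProj_copy (L : Set S) (i : Fin m) (x : X.carrier) :
    X.integralProj q L (X.integralCopy i x) = if (q i).1.2 ∈ L then x else 0 := by
  have : ∀ j, (if (q j).1.2 ∈ L then (LinearMap.proj j : (Fin m → X.carrier) →ₗ[k] X.carrier)
      else 0) (Pi.single i x) = if j = i then (if (q i).1.2 ∈ L then x else 0) else 0 := by
    intro j
    by_cases hj : j = i
    · subst hj
      by_cases h : (q j).1.2 ∈ L <;> simp [h]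
    · by_cases h : (q j).1.2 ∈ L <;> simp [h, hj]
  simp [integralProj, this]

/-- This bounds the derivative from above: the projection is the identity on `X`, so a vector of `X`
in the sum of the subspaces below `t` must lie in `X(t)`. For a pair `(a, b)`, a generator `x - copy
x` has `b ≤ t` and is sent to `0`. A generator `copy x` has `a ≤ t`; it is sent to `0` unless also
`b ≤ t`, and then `a ∨ b ≤ t` gives `x ∈ X(t)`. -/
lemma integralSub_le_comap_integralProj (t : DerivedPoset p) {s : S}
    (hs : IdealExt.embed p s ≤ DerivedPoset.incl p t) :
    X.integralSub q s ≤ (X.sub t).comap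
      (X.integralProj q {s | IdealExt.embed p s ≤ DerivedPoset.incl p t}) := by
  classical
  have hle : ∀ i, IdealExt.embed p (q i).1.1 ≤ DerivedPoset.incl p t →
      IdealExt.embed p (q i).1.2 ≤ DerivedPoset.incl p t → X.sub (q i).join ≤ X.sub t := by
    intro i h₁ h₂
    refine X.mono ?_
    rintro a (rfl | rfl)
    · exact h₁ _ rfl
    · exact h₂ _ rfl
  refine sup_le ?_ (sup_le ?_ ?_)
  · rintro _ ⟨x, hx, rfl⟩
    have hsp : s ∈ (Set.Ici p)ᶜ := fun h =>
      t.2 (((IdealExt.embed p).le_iff_le.2 h).trans hs)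
    rw [Submodule.mem_comap, LinearMap.inl_apply, integralProj_inl]
    exact X.mono (show DerivedPoset.ofElem p s hsp ≤ t from hs) ((Submodule.mem_iInf _).1 hx hsp)
  · refine iSup₂_le fun i hi => ?_
    rintro _ ⟨x, hx, rfl⟩
    rw [Submodule.mem_comap, integralProj_copy]
    split_ifs with h
    · exact hle i (((IdealExt.embed p).le_iff_le.2 hi).trans hs) h hx
    · exact zero_mem _
  · refine iSup₂_le fun i hi => ?_
    rintro _ ⟨x, hx, rfl⟩
    have h : (q i).1.2 ∈ {s | IdealExt.embed p s ≤ DerivedPoset.incl p t} :=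
      ((IdealExt.embed p).le_iff_le.2 hi).trans hs
    rw [Submodule.mem_comap, LinearMap.sub_apply, map_sub, integralProj_copy, if_pos h,
      LinearMap.inl_apply, integralProj_inl, sub_self]
    exact zero_mem _

/-- An `S`-space whose derivative is `X`, provided that `q` enumerates all pairs `(a, b)` that form
an antichain together with `p`: each vector `x` of `X(a ∨ b)` is written in the generic way
as the sum of a new vector of the subspace at `a` and a vector of the subspace at `b`. -/
def integral : SSpace k S where
  carrier := X.carrier × (Fin m → X.carrier)
  sub := X.integralSub q
  mono := X.integralSub_mono q

/-- The inclusion of the ambient space of `X`. -/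
def integralInl : X.carrier →ₗ[k] (X.integral q).carrier :=
  LinearMap.inl k X.carrier (Fin m → X.carrier)

lemma integralInl_injective : Function.Injective (X.integralInl q) :=
  LinearMap.inl_injective

lemma range_integralInl : LinearMap.range (X.integralInl q) = (X.integral q).sub p :=
  (X.integralSub_self q).symm

lemma integralInl_mem_joinSub_iff (hS : WidthLeTwo ((Set.Iic p)ᶜ : Set S))
    (hq : Function.Surjective q) (t : DerivedPoset p) (x : X.carrier) :
    X.integralInl q x ∈ joinSub (X.integral q) (DerivedPoset.incl p t) ↔ x ∈ X.sub t := by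
  constructor
  · intro h
    let Z : Submodule k (X.integral q).carrier :=
      (X.sub t).comap (X.integralProj q {s | IdealExt.embed p s ≤ DerivedPoset.incl p t})
    have hle : joinSub (X.integral q) (DerivedPoset.incl p t) ≤ Z :=
      iSup₂_le fun s hs => X.integralSub_le_comap_integralProj q t hs
    exact (X.integralProj_inl q _ x) ▸ hle h
  · intro hx
    rcases DerivedPoset.eq_ofElem_or_eq_join hS t with ⟨s, hs, rfl⟩ | ⟨a, b, ha, hb, h, rfl⟩
    · exact (joinSub_ofElem (X.integral q) hs).ge (X.inl_mem_integralSub q fun _ => hx)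
    · obtain ⟨i, hi⟩ := hq ⟨(a, b), ha, hb, h⟩
      have hxi : x ∈ X.sub (q i).join := by
        rw [hi]
        exact hx
      have h₁ := X.integralCopy_mem_integralSub q hxi
      have h₂ := X.inl_sub_integralCopy_mem_integralSub q hxi
      rw [hi] at h₁ h₂
      exact (joinSub_join (X.integral q) ha hb h).ge (Submodule.mem_sup.2
        ⟨_, h₁, _, h₂, add_sub_cancel (X.integralCopy i x) (LinearMap.inl k _ _ x)⟩)

/-- The derivative of `integral X q` is `X`. -/
noncomputable def diffIntegralIso (hS : WidthLeTwo ((Set.Iic p)ᶜ : Set S))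
    (hq : Function.Surjective q) : X ≅ (diff k p).obj (X.integral q) :=
  isoOfLinearEquiv
    ((LinearEquiv.ofInjective (X.integralInl q) (X.integralInl_injective q)).trans
      ((LinearEquiv.ofEq _ _ (X.range_integralInl q)).trans (diffEquiv p (X.integral q))))
    fun t x => (X.integralInl_mem_joinSub_iff q hS hq t x).symm

end Integral

lemma diff_essSurj [Finite S] (hS : WidthLeTwo ((Set.Iic p)ᶜ : Set S)) :
    (diff k p).EssSurj where
  mem_essImage X := by
    -- All ordered pairs are enumerated, including both orders and `a = b`. The redundancy is
    -- harmless: only surjectivity is used.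
    obtain ⟨m, ⟨e⟩⟩ := Finite.exists_equiv_fin (AntichainPair p)
    exact ⟨X.integral e.symm, ⟨(X.diffIntegralIso e.symm hS e.symm.surjective).symm⟩⟩

/-! ## Spaces with no nonzero summand trivial at `p` -/

/-- The inclusion of the first summand. -/
def directSumInl (U W : SSpace k S) : U ⟶ U.directSum W :=
  Hom.mk (LinearMap.inl k _ _) fun s => Submodule.map_le_iff_le_comap.2 fun _ hx =>
    ⟨hx, (W.sub s).zero_mem⟩

/-- The projection to the first summand. -/
def directSumFst (U W : SSpace k S) : U.directSum W ⟶ U :=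
  Hom.mk (LinearMap.fst k _ _) fun _ => Submodule.map_le_iff_le_comap.2 fun _ hx => hx.1

/-- A summand trivial at `p` does not contribute to the derivative. -/
def diffDirectSumIso (U W : SSpace k S) (hW : W.IsTrivialAt p) :
    (diff k p).obj U ≅ (diff k p).obj (U.directSum W) where
  hom := (diff k p).map (directSumInl U W)
  inv := (diff k p).map (directSumFst U W)
  hom_inv_id := by
    rw [← Functor.map_comp, ← CategoryTheory.Functor.map_id]
    rfl
  inv_hom_id := by
    rw [← Functor.map_comp, ← CategoryTheory.Functor.map_id, ← sub_eq_zero, ← diff_map_sub, diff_map_eq_zero_iff]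
    rintro ⟨x, y⟩ ⟨-, hy⟩
    have hy0 : y = 0 := by
      have : y ∈ W.sub p := hy
      rwa [show W.sub p = ⊥ from hW, Submodule.mem_bot] at this
    subst hy0
    exact sub_self ((x, 0) : U.carrier × W.carrier)

/-- Nonzero summands trivial at `p` are removed one at a time; the dimension drops and the
derivative stays the same. -/
lemma exists_noTrivialSummand_diff_iso (p : S) (V : SSpace k S) :
    ∃ U : SSpace k S, noTrivialSummand k p U ∧ Nonempty ((diff k p).obj U ≅ (diff k p).obj V) := by
  induction hd : Module.finrank k V.carrier using Nat.strong_induction_on generalizing V with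
  | _ d ih =>
  by_cases hV : noTrivialSummand k p V
  · exact ⟨V, hV, ⟨Iso.refl _⟩⟩
  simp only [noTrivialSummand, not_forall] at hV
  obtain ⟨U, W, ⟨i⟩, hW, hW0⟩ := hV
  have hrank : Module.finrank k V.carrier =
      Module.finrank k U.carrier + Module.finrank k W.carrier :=
    (linearEquivOfIso i).finrank_eq.trans (Module.finrank_prod (M := U.carrier) (M' := W.carrier))
  have hpos : 0 < Module.finrank k W.carrier := by
    rw [Module.finrank_pos_iff]
    exact not_subsingleton_iff_nontrivial.1 hW0
  obtain ⟨U', hU', ⟨j⟩⟩ := ih _ (by omega) U rfl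
  exact ⟨U', hU', ⟨j ≪≫ diffDirectSumIso U W hW ≪≫ ((diff k p).mapIso i).symm⟩⟩

/-! ### Fitting decomposition and reflection of isomorphisms. -/

lemma lin_pow {V : SSpace k S} (e : End V) (n : ℕ) : lin (e ^ n : End V) = lin e ^ n := by
  induction n with
  | zero => rfl
  | succ n ih =>
    rw [pow_succ, pow_succ, ← ih]
    rfl

/-- The subspace `K` of the ambient space with the subspaces `V(s) ∩ K`. -/
def induced (V : SSpace k S) (K : Submodule k V.carrier) : SSpace k S where
  carrier := K
  sub s := (V.sub s).comap K.subtype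
  mono _ _ h := Submodule.comap_mono (V.mono h)

/-- Fitting's lemma: a high power of an endomorphism gives a decomposition of an `S`-space. -/
lemma eventually_fitting [Finite S] {V : SSpace k S} (e : V ⟶ V) :
    ∀ᶠ n in Filter.atTop, IsCompl (LinearMap.ker (lin e ^ n)) (LinearMap.range (lin e ^ n)) ∧
      Nonempty (V ≅ (V.induced (LinearMap.ker (lin e ^ n))).directSum
        (V.induced (LinearMap.range (lin e ^ n)))) := by
  have hs : ∀ s, ∀ x ∈ V.sub s, lin e x ∈ V.sub s := fun s x hx => lin_mem e hx
  -- As `S` is finite, one exponent serves the ambient space and all `V(s)` at once. A vector of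
  -- `V(s)` then decomposes inside `V(s)`, and by uniqueness this is its decomposition in `V`.
  filter_upwards [LinearMap.eventually_isCompl_ker_pow_range_pow (lin e),
    Filter.eventually_all.2 fun s =>
      LinearMap.eventually_isCompl_ker_pow_range_pow ((lin e).restrict (hs s))] with n hn hns
  suffices key : ∀ s (a : LinearMap.ker (lin e ^ n)) (b : LinearMap.range (lin e ^ n)),
      (a + b : V.carrier) ∈ V.sub s → (a : V.carrier) ∈ V.sub s ∧ (b : V.carrier) ∈ V.sub s from
    ⟨hn, ⟨(isoOfLinearEquiv (U := (V.induced (LinearMap.ker (lin e ^ n))).directSum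
      (V.induced (LinearMap.range (lin e ^ n)))) (Submodule.prodEquivOfIsCompl _ _ hn) fun s x =>
        ⟨fun h => (V.sub s).add_mem h.1 h.2, key s x.1 x.2⟩).symm⟩⟩
  intro s a b h
  have hmem : (⟨a + b, h⟩ : V.sub s) ∈ LinearMap.ker ((lin e).restrict (hs s) ^ n) ⊔
      LinearMap.range ((lin e).restrict (hs s) ^ n) := (hns s).sup_eq_top ▸ Submodule.mem_top
  obtain ⟨a', ha', _, ⟨c, rfl⟩, hab⟩ := Submodule.mem_sup.1 hmem
  have hc : (((lin e).restrict (hs s) ^ n) c : V.carrier) = (lin e ^ n) c := by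
    rw [Module.End.pow_restrict]
    rfl
  have ha : (a' : V.carrier) ∈ LinearMap.ker (lin e ^ n) := by
    rw [LinearMap.mem_ker, Module.End.pow_restrict] at ha'
    exact congrArg (fun z : V.sub s => (z : V.carrier)) ha'
  have heq : (Submodule.prodEquivOfIsCompl _ _ hn) (⟨a', ha⟩, ⟨_, c, rfl⟩) =
      (Submodule.prodEquivOfIsCompl _ _ hn) (a, b) := by
    have := congrArg (fun z : V.sub s => (z : V.carrier)) hab
    simpa [hc] using this
  have := (Submodule.prodEquivOfIsCompl _ _ hn).injective heq
  obtain ⟨rfl, rfl⟩ := Prod.ext_iff.1 this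
  refine ⟨a'.2, ?_⟩
  change (lin e ^ n) c ∈ V.sub s
  rw [← hc]
  exact Submodule.coe_mem _

/-- An endomorphism of a space with no nonzero summand trivial at `p` is invertible if its
derivative is the identity. -/
lemma isIso_of_diff_map_eq_id [Finite S] {V : SSpace k S} (hV : noTrivialSummand k p V)
    (h : V ⟶ V) (hh : (diff k p).map h = 𝟙 _) : IsIso h := by
  let e : End V := 𝟙 V - h
  have he : ∀ x ∈ V.sub p, lin e x = 0 := by
    rw [← diff_map_eq_zero_iff, diff_map_sub, hh, CategoryTheory.Functor.map_id, sub_self]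
  -- With `n ≥ 1` the power `e ^ n` still kills `V(p)`, so `V(p)` lies in its kernel and meets its
  -- image in zero.
  obtain ⟨n, ⟨hn, hiso⟩, hn1⟩ := ((eventually_fitting e).and (Filter.eventually_ge_atTop 1)).exists
  have htriv : (V.induced (LinearMap.range (lin e ^ n))).IsTrivialAt p := by
    refine (Submodule.eq_bot_iff _).2 fun (y : LinearMap.range (lin e ^ n))
      (hy : (y : V.carrier) ∈ V.sub p) => ?_
    have hker : (y : V.carrier) ∈ LinearMap.ker (lin e ^ n) :=
      Module.End.pow_map_zero_of_le hn1 ((congrArg (· (y : V.carrier)) (pow_one (lin e))).trans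
        (he _ hy))
    exact Subtype.ext (Submodule.disjoint_def.1 hn.disjoint _ hker y.2)
  have hsub := hV _ _ hiso htriv
  have hnil : IsNilpotent e := by
    refine ⟨n, hom_ext ?_⟩
    rw [lin_pow]
    refine LinearMap.ext fun x => ?_
    have := hsub.elim (⟨(lin e ^ n) x, x, rfl⟩ : LinearMap.range (lin e ^ n)) 0
    exact congrArg Subtype.val this
  have hu : IsUnit (1 - e) := hnil.isUnit_one_sub
  have h1 : 1 - e = h := sub_sub_cancel (𝟙 V) h
  rw [h1] at hu
  exact (isUnit_iff_isIso h).1 hu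

/-- The differentiation functor reflects isomorphisms between spaces with no nonzero summand trivial
at `p`. -/
lemma isIso_of_isIso_diff_map [Finite S] (hS : WidthLeTwo ((Set.Iic p)ᶜ : Set S))
    {U V : SSpace k S} (hU : noTrivialSummand k p U) (hV : noTrivialSummand k p V) (f : U ⟶ V)
    [IsIso ((diff k p).map f)] : IsIso f := by
  have := diff_full (k := k) hS
  -- Fullness lifts the inverse of the derivative of `f`; both composites with `f` have identity
  -- derivative and hence are invertible.
  obtain ⟨g, hg⟩ := (diff k p).map_surjective (inv ((diff k p).map f))
  have h₁ : IsIso (f ≫ g) := isIso_of_diff_map_eq_id hU _ (by simp [hg])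
  have h₂ : IsIso (g ≫ f) := isIso_of_diff_map_eq_id hV _ (by simp [hg])
  have : IsSplitMono f := IsSplitMono.mk' ⟨g ≫ inv (f ≫ g), by
    rw [← Category.assoc, IsIso.hom_inv_id]⟩
  have : IsSplitEpi f := IsSplitEpi.mk' ⟨inv (g ≫ f) ≫ g, by
    rw [Category.assoc, IsIso.inv_hom_id]⟩
  exact isIso_of_epi_of_isSplitMono f

lemma isRepresentationEquivalence_diff [Finite S] (hS : WidthLeTwo ((Set.Iic p)ᶜ : Set S)) :
    IsRepresentationEquivalence ((noTrivialSummand k p).ι ⋙ diff k p) where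
  full := by
    have := diff_full (k := k) hS
    infer_instance
  dense :=
    { mem_essImage := fun X => by
        have := diff_essSurj (k := k) hS
        obtain ⟨U, hU, ⟨i⟩⟩ := exists_noTrivialSummand_diff_iso p ((diff k p).objPreimage X)
        exact ⟨⟨U, hU⟩, ⟨i ≪≫ (diff k p).objObjPreimageIso X⟩⟩ }
  reflects :=
    { reflects := fun {U V} f hf => by
        have : IsIso ((diff k p).map ((noTrivialSummand k p).ι.map f)) := hf
        have : IsIso ((noTrivialSummand k p).ι.map f) :=
          isIso_of_isIso_diff_map hS U.property V.property _
        exact (noTrivialSummand k p).fullyFaithfulι.isIso_of_isIso_map f }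

end SSpace

/-- A full and dense functor is an equivalence modulo its kernel. -/
lemma quotient_lift_isEquivalence {C : Type u} [Category.{v} C] {D : Type w} [Category.{x} D]
    (F : C ⥤ D) [F.Full] [F.EssSurj] (r : HomRel C) (hr : r = F.homRel) :
    ∃ H : ∀ (U V : C) (f g : U ⟶ V), r f g → F.map f = F.map g,
      (CategoryTheory.Quotient.lift r F H).IsEquivalence := by
  subst hr
  exact ⟨fun _ _ _ _ h => h, inferInstance⟩

end PosetRep

theorem theorem5p13 (k : Type u) [Field k] (S : Type v) [PartialOrder S] [Finite S] (p : S)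
    (hw : PosetRep.width ((Set.Iic p)ᶜ : Set S) ≤ 2) :
    -- the restriction to the spaces with no nonzero summand trivial at `p`
    PosetRep.IsRepresentationEquivalence
      ((PosetRep.SSpace.noTrivialSummand k p).ι ⋙ PosetRep.SSpace.diff k p) ∧
    -- the functor induced on the quotient category
    (∃ H : ∀ (U V : PosetRep.SSpace k S) (f g : U ⟶ V), PosetRep.SSpace.trivialRel k p f g →
        (PosetRep.SSpace.diff k p).map f = (PosetRep.SSpace.diff k p).map g,
      (CategoryTheory.Quotient.lift (PosetRep.SSpace.trivialRel k p)
        (PosetRep.SSpace.diff k p) H : PosetRep.SSpace.TrivialQuotient k p ⥤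
          PosetRep.SSpace k (PosetRep.DerivedPoset p)).IsEquivalence) ∧
    -- the elements of the derived poset
    (∀ t : PosetRep.DerivedPoset p,
      (∃ (s : S) (hs : s ∈ (Set.Ici p)ᶜ), t = PosetRep.DerivedPoset.ofElem p s hs) ∨
      (∃ (a b : S) (ha : a ∈ (Set.Iic p ∪ Set.Ici p)ᶜ) (hb : b ∈ (Set.Iic p ∪ Set.Ici p)ᶜ)
        (h : IsAntichain (· ≤ ·) ({p, a, b} : Set S)),
        t = PosetRep.DerivedPoset.join p a b ha hb h)) ∧
    -- the functor on objects
    (∀ V : PosetRep.SSpace k S,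
      Function.Injective (PosetRep.SSpace.diffIncl p V) ∧
      LinearMap.range (PosetRep.SSpace.diffIncl p V) = V.sub p ∧
      (∀ (s : S) (hs : s ∈ (Set.Ici p)ᶜ),
        (((PosetRep.SSpace.diff k p).obj V).sub (PosetRep.DerivedPoset.ofElem p s hs)).map
          (PosetRep.SSpace.diffIncl p V) = V.sub s ⊓ V.sub p) ∧
      (∀ (a b : S) (ha : a ∈ (Set.Iic p ∪ Set.Ici p)ᶜ) (hb : b ∈ (Set.Iic p ∪ Set.Ici p)ᶜ)
        (h : IsAntichain (· ≤ ·) ({p, a, b} : Set S)),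
        (((PosetRep.SSpace.diff k p).obj V).sub (PosetRep.DerivedPoset.join p a b ha hb h)).map
          (PosetRep.SSpace.diffIncl p V) = (V.sub a ⊔ V.sub b) ⊓ V.sub p)) ∧
    -- the functor on morphisms
    (∀ (U V : PosetRep.SSpace k S) (f : U ⟶ V) (x : ((PosetRep.SSpace.diff k p).obj U).carrier),
      PosetRep.SSpace.diffIncl p V
          (PosetRep.SSpace.lin ((PosetRep.SSpace.diff k p).map f) x) =
        PosetRep.SSpace.lin f (PosetRep.SSpace.diffIncl p U x)) := by
  have hS := PosetRep.widthLeTwo_of_width_le hw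
  have hfull := PosetRep.SSpace.diff_full (k := k) hS
  have hdense := PosetRep.SSpace.diff_essSurj (k := k) hS
  refine ⟨PosetRep.SSpace.isRepresentationEquivalence_diff hS,
    PosetRep.quotient_lift_isEquivalence _ _ PosetRep.SSpace.trivialRel_eq_homRel,
    PosetRep.DerivedPoset.eq_ofElem_or_eq_join hS, fun V => ?_,
    fun U V f x => PosetRep.SSpace.diffIncl_map f x⟩
  refine ⟨PosetRep.SSpace.diffIncl_injective V, PosetRep.SSpace.range_diffIncl V,
    fun s hs => ?_, fun a b ha hb h => ?_⟩
  · exact (PosetRep.SSpace.map_diffIncl_sub V _).trans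
      (congrArg (· ⊓ V.sub p) (PosetRep.SSpace.joinSub_ofElem V hs))
  · exact (PosetRep.SSpace.map_diffIncl_sub V _).trans
      (congrArg (· ⊓ V.sub p) (PosetRep.SSpace.joinSub_join V ha hb h))
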